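/- Let $K$ be a number field of degree $n$ with regulator $R$ and unit rank $r$. For each archimedean place $v$ of $K$ let $|\cdot|_v$ be the absolute value extending the usual one on $\mathbf Q$, $K_v$ the completion, $n_v=[K_v:\mathbf R]$, and $\lVert\cdot\rVert_v=|\cdot|_v^{n_v}$; the absolute value of a tuple is the maximum of the absolute values of its entries. Let $\mu_v$ be Lebesgue measure on $K_v^{m+1}$ (identifying $K_v$ with $\mathbf R$, or with $\mathbf C\cong\mathbf R^2$). Let $f:\mathbf P^m\to\mathbf P^M$ be a morphism of degree $d\ge 1$ defined over $K$, with lift $F=(F_0,\dots,F_M)$; that is, the $F_j$ are forms of degree $d$ in $m+1$ variables with coefficients $F_{j,\alpha}\in K$ and with no nontrivial common zero over $\overline K$. Put $|F|_v=\max_{j,\alpha}|F_{j,\alpha}|_v$, $\lVert F\rVert_v=|F|_v^{n_v}$, and $$D_{f,v}=\{z\in K_v^{m+1}:|F(z)|_v\le|F|_v\},\qquad c_{K,v}(f)=\mu_v(D_{f,v}),\qquad c_{K,\infty}(f)=\prod_{v\mid\infty}c_{K,v}(f).$$ Let $\Lambda(u)=(\log\lVert u\rVert_v)_{v\mid\infty}$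 for $u\in\mathcal O_K^\times$, let $\Lambda(\mathcal O_K^\times)\subset\prod_{v\mid\infty}\mathbf R$ be the unit lattice, and for $z=(z_v)_{v\mid\infty}\in K_{\mathbf R}^{m+1}:=\prod_{v\mid\infty}K_v^{m+1}$ and $y\in\prod_{v\mid\infty}\mathbf R$ put $$\rho(z)=\prod_{v\mid\infty}\lVert F(z_v)\rVert_v^{1/d},\qquad \eta(z)=\big(\log\lVert F(z_v)\rVert_v^{1/d}\big)_{v\mid\infty}\ \ (\text{for } z \text{ with all } z_v\ne0),\qquad \mathrm{pr}(y)=\Big(y_v-\frac{n_v}{n}\sum_{w\mid\infty}y_w\Big)_{v\mid\infty}.$$ **Proposition 8.6.** Let $b_1,\dots,b_r$ be any $\mathbf Z$-basis of the unit lattice, let $D_K=b_1[0,1)+\dots+b_r[0,1)$ be the corresponding fundamental parallelotope, and put $$D_{F,K}(1)=\{z\in K_{\mathbf R}^{m+1}:\rho(z)\le1\}\cap(\mathrm{pr}\circ\eta)^{-1}(D_K).$$ Then $D_{F,K}(1)$ is a Borel set of finite volume and, under the canonical identification $K_{\mathbf R}^{m+1}\cong\mathbf R^{n(m+1)}$ (so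 that volume is the product measure $\bigotimes_{v\mid\infty}\mu_v$), $$\operatorname{vol}D_{F,K}(1)=(m+1)^r\,R\,c_{K,\infty}(f)\prod_{v\mid\infty}\lVert F\rVert_v^{-(m+1)/d}.$$ -/

import Mathlib

noncomputable section

namespace SchanuelDomain

open MeasureTheory NumberField

section Local

variable {K : Type*} [Field K]

/-- The completion `K_v` at an infinite place carries its Borel σ-algebra. -/
instance instMeasurableSpaceCompletion (v : InfinitePlace K) : MeasurableSpace v.Completion :=
  borel v.Completion

instance instBorelSpaceCompletion (v : InfinitePlace K) : BorelSpace v.Completion := ⟨rfl⟩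

open Classical in
/-- Lebesgue measure on `K_v`: transported from `ℝ` when `v` is real and from `ℂ ≅ ℝ²` when `v`
is complex, along the canonical isometric identification. -/
def localVolume (v : InfinitePlace K) : Measure v.Completion :=
  if hv : v.IsReal then
    Measure.map (InfinitePlace.Completion.isometryEquivRealOfIsReal hv).symm
      (volume : Measure ℝ)
  else
    Measure.map (InfinitePlace.Completion.isometryEquivComplexOfIsComplex
      (InfinitePlace.not_isReal_iff_isComplex.mp hv)).symm (volume : Measure ℂ)

/-- Lebesgue measure `μ_v` on `K_v ^ (m + 1)`. -/
def localVolumePow (m : ℕ) (v : InfinitePlace K) : Measure (Fin (m + 1) → v.Completion) :=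
  Measure.pi fun _ => localVolume v

/-- `F = (F_0, …, F_M)` is a lift of a morphism `ℙ^m → ℙ^M` of degree `d` over `K`: the `F_j` are
forms of degree `d` over `K` without a nontrivial common zero over the algebraic closure. -/
structure IsLift {m M : ℕ} (d : ℕ) (F : Fin (M + 1) → MvPolynomial (Fin (m + 1)) K) : Prop where
  isHomogeneous : ∀ j, (F j).IsHomogeneous d
  no_common_zero : ∀ z : Fin (m + 1) → AlgebraicClosure K,
    (∀ j, MvPolynomial.aeval z (F j) = 0) → z = 0

variable {m M : ℕ} (F : Fin (M + 1) → MvPolynomial (Fin (m + 1)) K)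

/-- The value `F(z) ∈ K_v ^ (M + 1)` at `z ∈ K_v ^ (m + 1)`. Its norm `‖F(z)‖` in Lean (the sup
norm of the product) is `|F(z)|_v = max_j |F_j(z)|_v`. -/
def evalAt (v : InfinitePlace K) (z : Fin (m + 1) → v.Completion) : Fin (M + 1) → v.Completion :=
  fun j => MvPolynomial.aeval z (F j)

/-- `|F|_v`, the maximum of the absolute values `|F_{j,α}|_v` of the coefficients of `F`. -/
def coeffAbs (v : InfinitePlace K) : ℝ :=
  ((Finset.univ.sup fun j => (F j).support.sup fun α =>
    ‖algebraMap K v.Completion ((F j).coeff α)‖₊ : NNReal) : ℝ)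

/-- `D_{f,v} = {z ∈ K_v ^ (m + 1) : |F(z)|_v ≤ |F|_v}`, the local fundamental domain. -/
def localDomain (v : InfinitePlace K) : Set (Fin (m + 1) → v.Completion) :=
  {z | ‖evalAt F v z‖ ≤ coeffAbs F v}

/-- `c_{K,v}(f) = μ_v(D_{f,v})` for `v ∣ ∞`, as an extended nonnegative real. -/
def cLocal (v : InfinitePlace K) : ENNReal :=
  localVolumePow m v (localDomain F v)

end Local

section Global

variable (K : Type*) [Field K] [NumberField K]

/-- The Minkowski–Schanuel space `∏_{v ∣ ∞} K_v ^ (m + 1)`. -/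
abbrev MSSpace (m : ℕ) : Type _ := (v : InfinitePlace K) → Fin (m + 1) → v.Completion

/-- The measure `⨂_{v ∣ ∞} μ_v` on the Minkowski–Schanuel space, i.e. Lebesgue measure under the
canonical identification with `ℝ ^ (n (m + 1))`. -/
def msVolume (m : ℕ) : Measure (MSSpace K m) :=
  Measure.pi fun v => localVolumePow m v

/-- The logarithmic map `Λ : u ↦ (log ‖u‖_v)_v`, where `‖u‖_v = |u|_v ^ n_v`. -/
def unitLog : Additive (𝓞 K)ˣ →+ (InfinitePlace K → ℝ) where
  toFun u := fun v => Real.log (v ((u.toMul : (𝓞 K)ˣ) : K) ^ v.mult)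
  map_zero' := by
    funext v
    simp
  map_add' a b := by
    funext v
    have ha : v ((a.toMul : (𝓞 K)ˣ) : K) ≠ 0 := by simp
    have hb : v ((b.toMul : (𝓞 K)ˣ) : K) ≠ 0 := by simp
    simp only [toMul_add, Units.val_mul, map_mul, mul_pow, Pi.add_apply]
    exact Real.log_mul (pow_ne_zero _ ha) (pow_ne_zero _ hb)

/-- The unit lattice `Λ(𝓞_K^×)`. -/
def unitLattice : AddSubgroup (InfinitePlace K → ℝ) := (unitLog K).range

variable {K}

/-- The fundamental parallelotope `b_1 [0,1) + … + b_r [0,1)` of a `ℤ`-basis of the unit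
lattice. -/
def parallelotope (b : Module.Basis (Fin (Units.rank K)) ℤ (unitLattice K)) :
    Set (InfinitePlace K → ℝ) :=
  {y | ∃ t : Fin (Units.rank K) → ℝ, (∀ i, t i ∈ Set.Ico (0 : ℝ) 1) ∧
    y = ∑ i, t i • (b i : InfinitePlace K → ℝ)}

/-- The projection `pr(y)_v = y_v - (n_v / n) ∑_w y_w` onto the hyperplane `∑_v y_v = 0`. -/
def pr (y : InfinitePlace K → ℝ) : InfinitePlace K → ℝ :=
  fun v => y v - (v.mult : ℝ) / (Module.finrank ℚ K : ℝ) * ∑ w, y w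

variable {m M : ℕ} (d : ℕ) (F : Fin (M + 1) → MvPolynomial (Fin (m + 1)) K)

/-- `ρ(z) = ∏_{v ∣ ∞} ‖F(z_v)‖_v ^ (1 / d)`. -/
def rho (z : MSSpace K m) : ℝ :=
  ∏ v, (‖evalAt F v (z v)‖ ^ v.mult) ^ (1 / (d : ℝ))

/-- The domain `∏_{v ∣ ∞} (K_v ^ (m + 1) - 0)` of `η`. -/
def etaDom : Set (MSSpace K m) := {z | ∀ v, z v ≠ 0}

/-- `η(z) = (log ‖F(z_v)‖_v ^ (1 / d))_v`; only its values on `etaDom` are used. -/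
def eta (z : MSSpace K m) : InfinitePlace K → ℝ :=
  fun v => Real.log ((‖evalAt F v (z v)‖ ^ v.mult) ^ (1 / (d : ℝ)))

/-- `D_{F,S}(T) = {z : ρ(z) ≤ T} ∩ (pr ∘ η)⁻¹(S)`, the preimage being taken in the domain
of `η`. -/
def domain (S : Set (InfinitePlace K → ℝ)) (T : ℝ) : Set (MSSpace K m) :=
  {z | rho d F z ≤ T} ∩ {z | z ∈ etaDom ∧ pr (eta d F z) ∈ S}

/-- `c_{K,∞}(f) = ∏_{v ∣ ∞} c_{K,v}(f)`. -/
def cInfty : ENNReal := ∏ v : InfinitePlace K, cLocal F v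

end Global

end SchanuelDomain

end

/-! The volume is computed after pushing everything forward along `eta`. Locally, `z ↦ ‖F(z)‖` is
homogeneous of degree `d` and vanishes only at the origin, so its sublevel sets are bounded dilates
of one another. Hence the image of `μ_v` under `log ‖F‖_v ^ (1/d)` has distribution function `A_v *
exp ((m+1) y)` with `A_v = localConst d F v` (`map_log_homogeneous_Iic`), which determines its
density (`IsLift.map_etaAt`). By Tonelli, the image of `msVolume` has density `∏ A_v * (m+1)^(r+1) *
exp ((m+1) ∑ y_v)`, a function of `∑ y_v` alone (`IsLift.map_eta_msVolume`,
`prod_localConst_mul_exp`).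

Up to a null set the domain is the preimage of `logDomain b`, which is the image of the box `(-∞, 0]
× [0,1)^r` under a linear map of determinant `± R` (`setOf_pr_mem_parallelotope_eq_image`,
`abs_det_latticeCoord`) with `∑ y_v` as its unbounded coordinate. Since `(m+1) exp ((m+1) s)` has
integral `1` over `s ≤ 0`, the volume is `R * (m+1)^r * ∏ A_v`. -/

section MeasureTheory

open MeasureTheory

/-! ### Product measures and densities -/

/-- **Tonelli's theorem** for a product of functions of the separate variables, over `Fin n`. -/
theorem lintegral_fin_nat_prod_eq_prod {n : ℕ} {E : Fin n → Type*}
    {mE : ∀ i, MeasurableSpace (E i)} {μ : (i : Fin n) → Measure (E i)} [∀ i, SigmaFinite (μ i)]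
    {f : (i : Fin n) → E i → ENNReal} (hf : ∀ i, Measurable (f i)) :
    ∫⁻ x : (i : Fin n) → E i, ∏ i, f i (x i) ∂(Measure.pi μ) = ∏ i, ∫⁻ x, f i x ∂(μ i) := by
  induction n with
  | zero => simp
  | succ n n_ih =>
      rw [((measurePreserving_piFinSuccAbove μ 0).symm).lintegral_map_equiv,
        Fin.prod_univ_succ, ← n_ih (fun i => hf i.succ), ← lintegral_prod_mul (hf 0).aemeasurable]
      · simp only [Fin.prod_univ_succ]
        rfl
      · exact (Finset.measurable_prod _ fun i _ =>
          (hf i.succ).comp (measurable_pi_apply i)).aemeasurable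

/-- **Tonelli's theorem** for a product of functions of the separate variables. -/
theorem lintegral_fintype_prod_eq_prod {ι : Type*} [Fintype ι] {E : ι → Type*}
    {mE : ∀ i, MeasurableSpace (E i)} {μ : (i : ι) → Measure (E i)} [∀ i, SigmaFinite (μ i)]
    {f : (i : ι) → E i → ENNReal} (hf : ∀ i, Measurable (f i)) :
    ∫⁻ x : (i : ι) → E i, ∏ i, f i (x i) ∂(Measure.pi μ) = ∏ i, ∫⁻ x, f i x ∂(μ i) := by
  let e := (Fintype.equivFin ι).symm
  rw [(measurePreserving_piCongrLeft _ e).lintegral_map_equiv]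
  simp_rw [← e.prod_comp, MeasurableEquiv.coe_piCongrLeft, Equiv.piCongrLeft_apply_apply]
  exact lintegral_fin_nat_prod_eq_prod fun i => hf _

/-- A finite product of measures with densities has the product of the densities as density. -/
theorem pi_withDensity_eq {ι : Type*} [Fintype ι] {E : ι → Type*}
    {mE : ∀ i, MeasurableSpace (E i)} {μ : (i : ι) → Measure (E i)} [∀ i, SigmaFinite (μ i)]
    {f : (i : ι) → E i → ENNReal} (hf : ∀ i, Measurable (f i))
    [∀ i, SigmaFinite ((μ i).withDensity (f i))] :
    Measure.pi (fun i => (μ i).withDensity (f i)) =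
      (Measure.pi μ).withDensity fun x => ∏ i, f i (x i) := by
  classical
  refine Measure.pi_eq fun s hs => ?_
  rw [withDensity_apply _ (MeasurableSet.univ_pi hs), Measure.restrict_pi_pi,
    lintegral_fintype_prod_eq_prod hf]
  exact Finset.prod_congr rfl fun i _ => (withDensity_apply _ (hs i)).symm

/-! ### Sublevel sets of homogeneous functions and exponential distributions -/

section Homogeneous

variable {E : Type*} [NormedAddCommGroup E] [NormedSpace ℝ E] [FiniteDimensional ℝ E]
  {G : E → ℝ} {d : ℕ}

/-- The sublevel sets of a positive definite homogeneous function are bounded. -/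
theorem isBounded_setOf_le_of_homogeneous (hd : d ≠ 0) (hG : Continuous G)
    (h0 : ∀ z, 0 ≤ G z) (hpos : ∀ z, G z = 0 → z = 0)
    (hhom : ∀ (t : ℝ) z, 0 < t → G (t • z) = t ^ d * G z) (c : ℝ) :
    Bornology.IsBounded {z | G z ≤ c} := by
  obtain hS | hS := (Metric.sphere (0 : E) 1).eq_empty_or_nonempty
  · have hz : ∀ z : E, z = 0 := by
      intro z
      by_contra hz
      have : (‖z‖⁻¹ • z) ∈ Metric.sphere (0 : E) 1 := by
        simp [norm_smul, norm_ne_zero_iff.mpr hz]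
      simp [hS] at this
    exact (Metric.isBounded_closedBall (x := (0 : E)) (r := 0)).subset fun z _ => by simp [hz z]
  · obtain ⟨z₀, hz₀, hmin⟩ := (isCompact_sphere (0 : E) 1).exists_isMinOn hS hG.continuousOn
    have hδ : 0 < G z₀ := by
      refine lt_of_le_of_ne (h0 z₀) fun h => ?_
      have := hpos _ h.symm
      simp [this] at hz₀
    -- The lower bound `1` for the radius gives `‖z‖ ≤ ‖z‖ ^ d` outside the ball, so no `d`-th root
    -- of `c / G z₀` is needed.
    refine (Metric.isBounded_closedBall (x := (0 : E)) (r := max 1 (c / G z₀))).subset fun z hz => ?_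
    rw [mem_closedBall_zero_iff]
    by_contra! hlt
    have h1 : 1 < ‖z‖ := lt_of_le_of_lt (le_max_left _ _) hlt
    have h2 : c / G z₀ < ‖z‖ := lt_of_le_of_lt (le_max_right _ _) hlt
    have hz0 : 0 < ‖z‖ := by linarith
    have h3 := hmin (show ‖z‖⁻¹ • z ∈ Metric.sphere (0 : E) 1 by simp [norm_smul, hz0.ne'])
    have h4 : G z = ‖z‖ ^ d * G (‖z‖⁻¹ • z) := by
      rw [← hhom _ _ hz0, smul_inv_smul₀ hz0.ne']
    have h5 : ‖z‖ ≤ ‖z‖ ^ d := le_self_pow₀ h1.le hd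
    have h6 : G z₀ ≤ G (‖z‖⁻¹ • z) := h3
    rw [div_lt_iff₀ hδ] at h2
    have h7 : ‖z‖ * G z₀ ≤ ‖z‖ ^ d * G (‖z‖⁻¹ • z) := by gcongr
    have h8 : G z ≤ c := hz
    linarith

variable [MeasurableSpace E] (μ : Measure E) [μ.IsAddHaarMeasure]

theorem measure_setOf_le_lt_top_of_homogeneous (hd : d ≠ 0) (hG : Continuous G)
    (h0 : ∀ z, 0 ≤ G z) (hpos : ∀ z, G z = 0 → z = 0)
    (hhom : ∀ (t : ℝ) z, 0 < t → G (t • z) = t ^ d * G z) (c : ℝ) :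
    μ {z | G z ≤ c} < ⊤ :=
  (isBounded_setOf_le_of_homogeneous hd hG h0 hpos hhom c).measure_lt_top

variable [BorelSpace E]

/-- Homogeneity makes the left set the dilate by `s` of the right one. -/
theorem measure_setOf_le_mul_pow_of_homogeneous
    (hhom : ∀ (t : ℝ) z, 0 < t → G (t • z) = t ^ d * G z) (c : ℝ) {s : ℝ} (hs : 0 < s) :
    μ {z | G z ≤ s ^ d * c} = ENNReal.ofReal (s ^ Module.finrank ℝ E) * μ {z | G z ≤ c} := by
  rw [← Measure.addHaar_smul_of_nonneg μ hs.le]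
  congr 1
  ext z
  rw [Set.mem_smul_set_iff_inv_smul_mem₀ hs.ne', Set.mem_ofPred_eq, Set.mem_ofPred_eq,
    hhom _ _ (inv_pos.mpr hs), inv_pow, inv_mul_le_iff₀ (pow_pos hs d)]

/-- The distribution of the logarithm of a positive definite homogeneous function. -/
theorem map_log_homogeneous_Iic (hd : d ≠ 0) (h0 : ∀ z, 0 ≤ G z) (hpos : ∀ z, G z = 0 → z = 0)
    (hhom : ∀ (t : ℝ) z, 0 < t → G (t • z) = t ^ d * G z)
    {c : ℝ} (hc : 0 < c) {k n : ℕ} (hk : k ≠ 0) (hn : n ≠ 0) (hD : Module.finrank ℝ E = k * n)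
    (y : ℝ) :
    μ {z | Real.log ((G z ^ k) ^ (1 / (d : ℝ))) ≤ y} =
      ENNReal.ofReal (Real.exp (n * y)) *
        (μ {z | G z ≤ c} * ENNReal.ofReal ((c ^ k) ^ (-(n : ℝ) / d))) := by
  have hd' : (d : ℝ) ≠ 0 := Nat.cast_ne_zero.mpr hd
  have hk' : (k : ℝ) ≠ 0 := Nat.cast_ne_zero.mpr hk
  have : Nontrivial E := Module.nontrivial_of_finrank_pos (R := ℝ)
    (by rw [hD]; exact Nat.pos_of_ne_zero (mul_ne_zero hk hn))
  -- Chosen so that `s ^ d * c = exp (y d / k)`, the value of `G` at which `log (G ^ (k / d)) = y`.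
  set s : ℝ := Real.exp (y / k) * c ^ (-(1 : ℝ) / d) with hs
  have hs0 : 0 < s := mul_pos (Real.exp_pos _) (Real.rpow_pos_of_pos hc _)
  have hsd : s ^ d * c = Real.exp (y / k * d) := by
    rw [hs, mul_pow, ← Real.rpow_natCast (c ^ _), ← Real.rpow_mul hc.le, div_mul_cancel₀ _ hd',
      Real.rpow_neg_one, mul_assoc, inv_mul_cancel₀ hc.ne', mul_one, ← Real.exp_nat_mul, mul_comm]
  have hsD : s ^ Module.finrank ℝ E = Real.exp (n * y) * (c ^ k) ^ (-(n : ℝ) / d) := by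
    rw [hs, hD, mul_pow, ← Real.exp_nat_mul, ← Real.rpow_natCast (c ^ (_ : ℝ)),
      ← Real.rpow_mul hc.le, ← Real.rpow_natCast c k, ← Real.rpow_mul hc.le]
    push_cast
    congr 2 <;> field_simp
  -- Only almost everywhere: at the origin `Real.log 0 = 0`, so for `y < 0` the origin lies in the
  -- right set but not in the left.
  have hae : {z | Real.log ((G z ^ k) ^ (1 / (d : ℝ))) ≤ y} =ᵐ[μ] {z | G z ≤ s ^ d * c} := by
    have hz0 : ∀ᵐ z ∂μ, z ≠ 0 := by simp [ae_iff]
    filter_upwards [hz0] with z hz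
    have hGz : 0 < G z := (h0 z).lt_of_ne fun h => hz (hpos z h.symm)
    refine propext ?_
    change Real.log ((G z ^ k) ^ (1 / (d : ℝ))) ≤ y ↔ G z ≤ s ^ d * c
    rw [hsd, ← Real.log_le_iff_le_exp hGz, Real.log_rpow (pow_pos hGz k), Real.log_pow]
    have hk0 : (0 : ℝ) < k := by positivity
    have hd0 : (0 : ℝ) < d := by positivity
    rw [one_div, inv_mul_le_iff₀ hd0, div_mul_eq_mul_div, le_div_iff₀ hk0, mul_comm y, mul_comm (k : ℝ)]
  rw [measure_congr hae, measure_setOf_le_mul_pow_of_homogeneous μ hhom c hs0, hsD,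
    ENNReal.ofReal_mul (Real.exp_pos _).le]
  ring

end Homogeneous

theorem integral_Ioc_mul_exp (n : ℝ) {a b : ℝ} (hab : a ≤ b) :
    ∫ y in Set.Ioc a b, n * Real.exp (n * y) = Real.exp (n * b) - Real.exp (n * a) := by
  rw [← intervalIntegral.integral_of_le hab]
  refine intervalIntegral.integral_eq_sub_of_hasDerivAt (f := fun y => Real.exp (n * y)) ?_ ?_
  · intro y _
    simpa [mul_comm] using ((hasDerivAt_id y).const_mul n).exp
  · exact (by fun_prop : Continuous fun y : ℝ => n * Real.exp (n * y)).intervalIntegrable _ _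

/-- A measure on `ℝ` with distribution function `A * exp (n * y)` has density
`A * n * exp (n * y)`. -/
theorem eq_withDensity_exp_of_Iic {ν : Measure ℝ} {A : ENNReal} (hA : A ≠ ⊤) {n : ℝ} (hn : 0 ≤ n)
    (h : ∀ y, ν (Set.Iic y) = ENNReal.ofReal (Real.exp (n * y)) * A) :
    ν = volume.withDensity fun y => A * ENNReal.ofReal (n * Real.exp (n * y)) := by
  have hfin : ∀ y, ν (Set.Iic y) ≠ ⊤ := fun y => by
    rw [h]; exact ENNReal.mul_ne_top ENNReal.ofReal_ne_top hA
  refine Measure.ext_of_Ioc' _ _ (fun a b _ =>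
    ne_top_of_le_ne_top (hfin b) (measure_mono Set.Ioc_subset_Iic_self)) fun a b hab => ?_
  have hm : Measurable fun y : ℝ => ENNReal.ofReal (n * Real.exp (n * y)) := by fun_prop
  rw [withDensity_apply _ measurableSet_Ioc, lintegral_const_mul _ hm,
    ← ofReal_integral_eq_lintegral_ofReal, integral_Ioc_mul_exp n hab.le,
    ← Set.Iic_sdiff_Iic, measure_sdiff (Set.Iic_subset_Iic.mpr hab.le)
      measurableSet_Iic.nullMeasurableSet (hfin a), h, h,
    ENNReal.ofReal_sub _ (Real.exp_pos _).le, mul_comm A, ENNReal.sub_mul fun _ _ => hA]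
  · exact (by fun_prop : Continuous fun y : ℝ => n * Real.exp (n * y)).integrableOn_Ioc
  · exact Filter.Eventually.of_forall fun y => by positivity

end MeasureTheory

namespace SchanuelDomain

open MeasureTheory NumberField

/-! ### Zeros and homogeneity of a lift -/

section Polynomial

variable {K : Type*} [Field K] {m M d : ℕ} {F : Fin (M + 1) → MvPolynomial (Fin (m + 1)) K}

/-- By the Nullstellensatz, the lift of a morphism has no nontrivial zero over any extension
field. -/
theorem IsLift.eq_zero_of_aeval_eq_zero (hF : IsLift d F) {L : Type*} [Field L] [Algebra K L]
    {z : Fin (m + 1) → L} (hz : ∀ j, MvPolynomial.aeval z (F j) = 0) : z = 0 := by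
  funext i
  set I : Ideal (MvPolynomial (Fin (m + 1)) K) := Ideal.span (Set.range F) with hI
  -- Each coordinate vanishes on the common zeros over the algebraic closure, so a power of it lies
  -- in the ideal of the `F j`, which evaluation at `z` kills.
  have hX : MvPolynomial.X i ∈ I.radical := by
    rw [← MvPolynomial.vanishingIdeal_zeroLocus_eq_radical (K := AlgebraicClosure K),
      MvPolynomial.mem_vanishingIdeal_iff]
    intro x hx
    have : x = 0 := hF.no_common_zero x fun j =>
      hx (F j) (Ideal.subset_span (Set.mem_range_self j))
    simp [this]
  obtain ⟨N, hN⟩ := hX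
  have hle : I ≤ RingHom.ker (MvPolynomial.aeval (R := K) z) := by
    rw [hI, Ideal.span_le]
    rintro _ ⟨j, rfl⟩
    exact hz j
  have h0 := hle hN
  rw [RingHom.mem_ker, map_pow, MvPolynomial.aeval_X] at h0
  exact eq_zero_of_pow_eq_zero h0

theorem IsLift.aeval_smul (hF : IsLift d F) {L : Type*} [Field L] [Algebra K L] (c : L)
    (z : Fin (m + 1) → L) (j : Fin (M + 1)) :
    MvPolynomial.aeval (c • z) (F j) = c ^ d * MvPolynomial.aeval z (F j) := by
  rw [MvPolynomial.aeval_def, MvPolynomial.aeval_def, MvPolynomial.eval₂_eq',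
    MvPolynomial.eval₂_eq', Finset.mul_sum]
  refine Finset.sum_congr rfl fun α hα => ?_
  have hα' : ∑ i, α i = d := by
    rw [← (hF.isHomogeneous j) (MvPolynomial.mem_support_iff.mp hα), Finsupp.weight_apply,
      Finsupp.sum_fintype _ _ (by simp)]
    simp
  simp only [Pi.smul_apply, smul_eq_mul, mul_pow, Finset.prod_mul_distrib]
  rw [Finset.prod_pow_eq_pow_sum, hα']
  ring

theorem IsLift.coeffAbs_pos (hF : IsLift d F) (v : InfinitePlace K) :
    0 < coeffAbs F v := by
  -- Otherwise `(1, …, 1)` would be a nontrivial common zero.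
  obtain ⟨j, hj⟩ : ∃ j, F j ≠ 0 := by
    by_contra! h
    have := hF.no_common_zero 1 fun j => by simp [h j]
    simpa using congrFun this 0
  obtain ⟨α, hα⟩ := MvPolynomial.ne_zero_iff.mp hj
  rw [coeffAbs, NNReal.coe_pos]
  refine lt_of_lt_of_le ?_ ((Finset.le_sup (f := fun α =>
    ‖algebraMap K v.Completion ((F j).coeff α)‖₊) (MvPolynomial.mem_support_iff.mpr hα)).trans
    (Finset.le_sup (f := fun j => (F j).support.sup fun α =>
    ‖algebraMap K v.Completion ((F j).coeff α)‖₊) (Finset.mem_univ j)))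
  rw [nnnorm_pos]
  exact (map_ne_zero_iff _ (algebraMap K v.Completion).injective).mpr hα

theorem continuous_evalAt (F : Fin (M + 1) → MvPolynomial (Fin (m + 1)) K) (v : InfinitePlace K) :
    Continuous (evalAt F v) := by
  refine continuous_pi fun j => ?_
  simp only [evalAt, MvPolynomial.aeval_def, MvPolynomial.eval₂_eq']
  fun_prop

theorem IsLift.evalAt_smul (hF : IsLift d F) (v : InfinitePlace K) (c : v.Completion)
    (z : Fin (m + 1) → v.Completion) : evalAt F v (c • z) = c ^ d • evalAt F v z :=
  funext fun j => hF.aeval_smul c z j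

theorem IsLift.eq_zero_of_norm_evalAt_eq_zero (hF : IsLift d F) {v : InfinitePlace K}
    {z : Fin (m + 1) → v.Completion} (hz : ‖evalAt F v z‖ = 0) : z = 0 :=
  hF.eq_zero_of_aeval_eq_zero fun j => congrFun (norm_eq_zero.mp hz) j

end Polynomial

/-! ### Local volumes at an infinite place -/

section Local

variable {K : Type*} [Field K] {m M d : ℕ} {F : Fin (M + 1) → MvPolynomial (Fin (m + 1)) K}

/-- Makes the product σ-algebra on `K_v ^ (m + 1)` the Borel one, so that continuous functions there
are measurable. -/
instance instSecondCountableTopologyCompletion (v : InfinitePlace K) :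
    SecondCountableTopology v.Completion :=
  (InfinitePlace.Completion.isometry_extensionEmbedding v).isEmbedding.secondCountableTopology

variable {v : InfinitePlace K} {𝕜 : Type*} [RCLike 𝕜]

theorem IsLift.norm_evalAt_smul (hF : IsLift d F) {ψ : 𝕜 ≃+* v.Completion} (hψ : Isometry ψ) (t : ℝ)
    (z : Fin (m + 1) → 𝕜) (ht : 0 < t) :
    ‖evalAt F v fun i => ψ ((t • z) i)‖ = t ^ d * ‖evalAt F v fun i => ψ (z i)‖ := by
  have h1 : (fun i => ψ ((t • z) i)) = ψ (t : 𝕜) • fun i => ψ (z i) := by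
    funext i
    simp [RCLike.real_smul_eq_coe_mul]
  have h2 : ‖ψ (t : 𝕜)‖ = t := by
    rw [← dist_zero_right, ← map_zero ψ, hψ.dist_eq, dist_zero_right, RCLike.norm_ofReal,
      abs_of_pos ht]
  rw [h1, hF.evalAt_smul, norm_smul, norm_pow, h2]

variable [MeasurableSpace 𝕜] [BorelSpace 𝕜] {μ : Measure 𝕜} [μ.IsAddHaarMeasure]

theorem sigmaFinite_localVolume_of_isometry (ψ : 𝕜 ≃ᵢ v.Completion)
    (hμ : localVolume v = μ.map ψ) : SigmaFinite (localVolume v) := by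
  rw [hμ]
  exact ψ.toHomeomorph.toMeasurableEquiv.sigmaFinite_map

/-- `S` is arbitrary because the identification is a measurable equivalence. -/
theorem localVolumePow_apply_of_isometry (ψ : 𝕜 ≃ᵢ v.Completion) (hμ : localVolume v = μ.map ψ)
    (S : Set (Fin (m + 1) → v.Completion)) :
    localVolumePow m v S = Measure.pi (fun _ => μ) {z : Fin (m + 1) → 𝕜 | (fun i => ψ (z i)) ∈ S} := by
  have hσ := sigmaFinite_localVolume_of_isometry ψ hμ
  rw [hμ] at hσ
  have hΨ := Measure.pi_map_pi (ι := Fin (m + 1)) (μ := fun _ => μ) (f := fun _ => ψ)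
    (fun _ => ψ.continuous.measurable.aemeasurable)
  rw [localVolumePow, hμ, ← hΨ]
  exact (MeasurableEquiv.piCongrRight fun _ : Fin (m + 1) =>
    ψ.toHomeomorph.toMeasurableEquiv).map_apply S

/-- The local volume computations, in terms of an identification of `K_v` with `ℝ` or `ℂ`. -/
theorem IsLift.localVolumePow_aux (hF : IsLift d F) (hd : 1 ≤ d)
    {ψ : 𝕜 ≃+* v.Completion} (hψ : Isometry ψ)
    (hμ : localVolume v = μ.map ψ) (hv : Module.finrank ℝ 𝕜 = v.mult) :
    SigmaFinite (localVolume v) ∧ localVolumePow m v {0} = 0 ∧ cLocal F v < ⊤ ∧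
    ∀ y : ℝ, localVolumePow m v
        {z | Real.log ((‖evalAt F v z‖ ^ v.mult) ^ (1 / (d : ℝ))) ≤ y} =
      ENNReal.ofReal (Real.exp (((m + 1 : ℕ) : ℝ) * y)) * (cLocal F v *
        ENNReal.ofReal ((coeffAbs F v ^ v.mult) ^ (-((m + 1 : ℕ) : ℝ) / d))) := by
  let ψ' : 𝕜 ≃ᵢ v.Completion := ⟨ψ.toEquiv, hψ⟩
  have hμ' : localVolume v = μ.map ψ' := hμ
  have hpos : ∀ z : Fin (m + 1) → 𝕜, ‖evalAt F v fun i => ψ (z i)‖ = 0 → z = 0 := fun z hz => by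
    funext i
    have := congrFun (hF.eq_zero_of_norm_evalAt_eq_zero hz) i
    simpa using this
  have hcont : Continuous fun z : Fin (m + 1) → 𝕜 => ‖evalAt F v fun i => ψ (z i)‖ := by
    have := hψ.continuous
    have := continuous_evalAt F v
    fun_prop
  refine ⟨sigmaFinite_localVolume_of_isometry ψ' hμ', ?_, ?_, fun y => ?_⟩
  · rw [localVolumePow_apply_of_isometry ψ' hμ']
    have : NullSingletonClass μ := Measure.IsAddHaarMeasure.nullSingletonClass μ
    refine nonpos_iff_eq_zero.mp <| (measure_mono ?_).trans_eq (measure_singleton (μ := Measure.pi fun _ : Fin (m + 1) => μ) 0)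
    intro z hz
    refine funext fun i => ?_
    have : ψ (z i) = 0 := congrFun hz i
    simpa using this
  · rw [cLocal, localVolumePow_apply_of_isometry ψ' hμ']
    exact measure_setOf_le_lt_top_of_homogeneous _ (by lia) hcont (fun _ => norm_nonneg _) hpos
      (hF.norm_evalAt_smul hψ) _
  · rw [cLocal, localVolumePow_apply_of_isometry ψ' hμ', localVolumePow_apply_of_isometry ψ' hμ']
    refine map_log_homogeneous_Iic _ (by lia) (fun _ => norm_nonneg _) hpos
      (hF.norm_evalAt_smul hψ) (hF.coeffAbs_pos v) InfinitePlace.mult_pos.ne' (by lia) ?_ y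
    simp [Module.finrank_pi_fintype, hv, mul_comm]

theorem IsLift.localVolumePow_spec (hF : IsLift d F) (hd : 1 ≤ d) (v : InfinitePlace K) :
    SigmaFinite (localVolume v) ∧ localVolumePow m v {0} = 0 ∧ cLocal F v < ⊤ ∧
    ∀ y : ℝ, localVolumePow m v
        {z | Real.log ((‖evalAt F v z‖ ^ v.mult) ^ (1 / (d : ℝ))) ≤ y} =
      ENNReal.ofReal (Real.exp (((m + 1 : ℕ) : ℝ) * y)) * (cLocal F v *
        ENNReal.ofReal ((coeffAbs F v ^ v.mult) ^ (-((m + 1 : ℕ) : ℝ) / d))) := by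
  by_cases hv : v.IsReal
  · refine hF.localVolumePow_aux
      (ψ := (InfinitePlace.Completion.ringEquivRealOfIsReal hv).symm) hd
      (InfinitePlace.Completion.isometryEquivRealOfIsReal hv).symm.isometry
      (μ := (volume : Measure ℝ)) ?_ ?_
    · rw [localVolume, dif_pos hv]
      rfl
    · simp [InfinitePlace.mult, hv]
  · have hv' := InfinitePlace.not_isReal_iff_isComplex.mp hv
    refine hF.localVolumePow_aux
      (ψ := (InfinitePlace.Completion.ringEquivComplexOfIsComplex hv').symm) hd
      (InfinitePlace.Completion.isometryEquivComplexOfIsComplex hv').symm.isometry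
      (μ := (volume : Measure ℂ)) ?_ ?_
    · rw [localVolume, dif_neg hv]
      rfl
    · simp [InfinitePlace.mult, hv]

end Local

end SchanuelDomain

/-! ### The unit lattice, the regulator and the logarithmic domain -/

namespace SchanuelDomain

open NumberField NumberField.Units

variable {K : Type*} [Field K]

theorem unitLog_apply (u : Additive (𝓞 K)ˣ) (v : InfinitePlace K) :
    unitLog K u v = v.mult * Real.log (v ((u.toMul : (𝓞 K)ˣ) : K)) :=
  Real.log_pow _ _

variable [NumberField K]

theorem sum_unitLog (u : Additive (𝓞 K)ˣ) : ∑ v, unitLog K u v = 0 := by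
  simp_rw [unitLog_apply]
  exact sum_mult_mul_log u.toMul

theorem toMul_mem_torsion_of_unitLog_eq_zero {u : Additive (𝓞 K)ˣ} (hu : unitLog K u = 0) :
    u.toMul ∈ torsion K := by
  rw [mem_torsion]
  intro v
  have := congrFun hu v
  rw [unitLog_apply, Pi.zero_apply] at this
  exact dirichletUnitTheorem.mult_log_place_eq_zero.mp this

/-- Units mapping to a `ℤ`-basis of the unit lattice generate the units modulo torsion. -/
theorem closure_sup_torsion_eq_top_of_basis
    (b : Module.Basis (Fin (Units.rank K)) ℤ (unitLattice K)) {u : Fin (Units.rank K) → (𝓞 K)ˣ}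
    (hu : ∀ i, unitLog K (Additive.ofMul (u i)) = b i) :
    Subgroup.closure (Set.range u) ⊔ torsion K = ⊤ := by
  refine eq_top_iff.mpr fun x _ => ?_
  set c := b.repr ⟨unitLog K (Additive.ofMul x), Additive.ofMul x, rfl⟩ with hc
  have hx : unitLog K (Additive.ofMul x) = ∑ i, c i • (b i : InfinitePlace K → ℝ) := by
    have := congrArg (unitLattice K).subtype
      (b.sum_repr ⟨unitLog K (Additive.ofMul x), Additive.ofMul x, rfl⟩)
    simp only [map_sum, map_zsmul] at this
    exact this.symm
  have hp : ∏ i, u i ^ c i ∈ Subgroup.closure (Set.range u) :=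
    Subgroup.prod_mem _ fun i _ =>
      Subgroup.zpow_mem _ (Subgroup.subset_closure (Set.mem_range_self i)) _
  have ht : (∏ i, u i ^ c i)⁻¹ * x ∈ torsion K := by
    refine toMul_mem_torsion_of_unitLog_eq_zero (u := Additive.ofMul ((∏ i, u i ^ c i)⁻¹ * x)) ?_
    rw [ofMul_mul, map_add, hx, ofMul_inv, map_neg, ofMul_prod, map_sum]
    simp [ofMul_zpow, hu]
  rw [← mul_inv_cancel_left (∏ i, u i ^ c i) x]
  exact mul_mem (Subgroup.mem_sup_left hp) (Subgroup.mem_sup_right ht)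

/-- The quotient of the two is the index of the subgroup generated by the family and the torsion,
here all units. -/
theorem regOfFamily_eq_regulator_of_basis
    (b : Module.Basis (Fin (Units.rank K)) ℤ (unitLattice K)) {u : Fin (Units.rank K) → (𝓞 K)ˣ}
    (hu : ∀ i, unitLog K (Additive.ofMul (u i)) = b i) :
    regOfFamily u = regulator K := by
  have := regOfFamily_div_regulator u
  rwa [closure_sup_torsion_eq_top_of_basis b hu, Subgroup.index_top, Nat.cast_one,
    div_eq_one_iff_eq (regulator_ne_zero K)] at this

/-- The point with coordinates `x` for the basis of `∏_v ℝ` which consists of `b` and of the vector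
`(n_v / n)_v`, the latter having the index `w₀`. -/
noncomputable def latticeCoord (w₀ : InfinitePlace K) (e : {w // w ≠ w₀} ≃ Fin (Units.rank K))
    (b : Fin (Units.rank K) → InfinitePlace K → ℝ) :
    (InfinitePlace K → ℝ) →ₗ[ℝ] (InfinitePlace K → ℝ) where
  toFun x := (∑ i, x (e.symm i) • b i) +
    x w₀ • fun v : InfinitePlace K => (v.mult : ℝ) / (Module.finrank ℚ K : ℝ)
  map_add' x y := by
    simp only [Pi.add_apply, add_smul, Finset.sum_add_distrib]
    abel
  map_smul' c x := by
    simp only [Pi.smul_apply, smul_eq_mul, mul_smul, Finset.smul_sum, RingHom.id_apply, smul_add]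

variable {w₀ : InfinitePlace K} {e : {w // w ≠ w₀} ≃ Fin (Units.rank K)}

theorem abs_det_latticeCoord (b : Module.Basis (Fin (Units.rank K)) ℤ (unitLattice K)) :
    |LinearMap.det (latticeCoord w₀ e fun i => b i)| = regulator K := by
  classical
  choose u hu using fun i => (b i).2
  have hn : (Module.finrank ℚ K : ℝ) ≠ 0 := Nat.cast_ne_zero.mpr Module.finrank_pos.ne'
  set A : Matrix (InfinitePlace K) (InfinitePlace K) ℝ := Matrix.of fun i w =>
    if h : i = w₀ then (w.mult : ℝ) else w.mult * (w ((u (e ⟨i, h⟩)).toMul : K)).log with hA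
  -- The regulator matrix completed by the row `(n_v)` at `w₀`; dividing that row by `n` and
  -- transposing yields the matrix of `latticeCoord`.
  have hAdet : |A.det| = Module.finrank ℚ K * regulator K := by
    rw [← regOfFamily_eq_regulator_of_basis b (u := fun i => (u i).toMul) hu,
      finrank_mul_regOfFamily_eq_det _ w₀ e]
  have hL : LinearMap.toMatrix' (latticeCoord w₀ e fun i => b i) =
      (Matrix.diagonal (fun i => if i = w₀ then (Module.finrank ℚ K : ℝ)⁻¹ else 1) * A).transpose := by
    ext w i
    rw [LinearMap.toMatrix'_apply, Matrix.transpose_apply, Matrix.diagonal_mul, hA, Matrix.of_apply]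
    by_cases h : i = w₀
    · subst h
      have : ∀ j, Pi.single (M := fun _ => ℝ) i 1 (e.symm j : InfinitePlace K) = 0 := fun j =>
        Pi.single_eq_of_ne (e.symm j).2 1
      simp [latticeCoord, this, div_eq_inv_mul]
    · rw [dif_neg h, if_neg h, one_mul]
      have h1 : Pi.single (M := fun _ => ℝ) i 1 w₀ = 0 := Pi.single_eq_of_ne (Ne.symm h) 1
      have h2 : ∀ j, Pi.single (M := fun _ => ℝ) i 1 (e.symm j : InfinitePlace K) =
          if j = e ⟨i, h⟩ then 1 else 0 := fun j => by
        rw [Pi.single_apply]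
        refine if_congr ?_ rfl rfl
        rw [← Equiv.symm_apply_eq, Subtype.ext_iff]
      simp [latticeCoord, h1, h2, ← hu, unitLog_apply]
  rw [← LinearMap.det_toMatrix', hL, Matrix.det_transpose, Matrix.det_mul, Matrix.det_diagonal,
    Finset.prod_ite_eq', if_pos (Finset.mem_univ _), abs_mul, hAdet, abs_inv, Nat.abs_cast,
    inv_mul_cancel_left₀ hn]

theorem sum_mult_div_finrank :
    ∑ v : InfinitePlace K, (v.mult : ℝ) / (Module.finrank ℚ K : ℝ) = 1 := by
  rw [← Finset.sum_div, ← Nat.cast_sum, InfinitePlace.sum_mult_eq,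
    div_self (Nat.cast_ne_zero.mpr Module.finrank_pos.ne')]

theorem sum_basis_apply (b : Module.Basis (Fin (Units.rank K)) ℤ (unitLattice K))
    (i : Fin (Units.rank K)) : ∑ v, (b i : InfinitePlace K → ℝ) v = 0 := by
  obtain ⟨u, hu⟩ := (b i).2
  rw [← hu, sum_unitLog]

/-- The lattice vectors have coordinate sum zero, and `(n_v / n)_v` has sum `1`. -/
theorem sum_latticeCoord (b : Module.Basis (Fin (Units.rank K)) ℤ (unitLattice K))
    (x : InfinitePlace K → ℝ) : ∑ v, latticeCoord w₀ e (fun i => b i) x v = x w₀ := by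
  simp only [latticeCoord, LinearMap.coe_mk, AddHom.coe_mk, Pi.add_apply, Finset.sum_apply,
    Pi.smul_apply, smul_eq_mul, Finset.sum_add_distrib]
  rw [Finset.sum_comm]
  simp_rw [← Finset.mul_sum]
  simp [sum_basis_apply, sum_mult_div_finrank]

/-- From `y = pr y + (∑ y_v) • (n_v / n)_v`: the parallelotope coordinates of `pr y` and the sum of
`y` are exactly the `latticeCoord` coordinates of `y`. -/
theorem setOf_pr_mem_parallelotope_eq_image
    (b : Module.Basis (Fin (Units.rank K)) ℤ (unitLattice K)) [DecidableEq (InfinitePlace K)] :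
    {y | ∑ v, y v ≤ 0 ∧ pr y ∈ parallelotope b} = latticeCoord w₀ e (fun i => b i) ''
      Set.univ.pi fun w => if w = w₀ then Set.Iic (0 : ℝ) else Set.Ico 0 1 := by
  ext y
  constructor
  · rintro ⟨hy, t, ht, hty⟩
    refine ⟨fun w => if h : w = w₀ then ∑ v, y v else t (e ⟨w, h⟩), ?_, ?_⟩
    · intro w _
      by_cases h : w = w₀
      · simpa [h] using hy
      · simpa [h] using ht _
    · have h1 : ∀ i, ((e.symm i : {w // w ≠ w₀}) : InfinitePlace K) ≠ w₀ := fun i => (e.symm i).2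
      funext v
      have h2 := congrFun hty v
      simp only [pr] at h2
      simp only [latticeCoord, LinearMap.coe_mk, AddHom.coe_mk, dif_neg (h1 _), Pi.add_apply,
        Subtype.coe_eta, Equiv.apply_symm_apply, ← h2, Pi.smul_apply, smul_eq_mul, dif_pos]
      ring
  · rintro ⟨x, hx, rfl⟩
    refine ⟨?_, fun i => x (e.symm i), fun i => ?_, ?_⟩
    · rw [sum_latticeCoord]
      simpa using hx w₀ trivial
    · simpa [(e.symm i).2] using hx (e.symm i) trivial
    · funext v
      simp only [pr, sum_latticeCoord]
      simp only [latticeCoord, LinearMap.coe_mk, AddHom.coe_mk, Pi.add_apply, Pi.smul_apply,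
        smul_eq_mul]
      ring

end SchanuelDomain

/-! ### Pushforward along `eta` and the integral over the logarithmic domain -/

namespace SchanuelDomain

open MeasureTheory NumberField

variable {K : Type*} [Field K] {m M d : ℕ} {F : Fin (M + 1) → MvPolynomial (Fin (m + 1)) K}

/-- `log ‖F(z)‖_v ^ (1 / d)`, the component of `η` at `v`. -/
noncomputable def etaAt (d : ℕ) (F : Fin (M + 1) → MvPolynomial (Fin (m + 1)) K)
    (v : InfinitePlace K) (z : Fin (m + 1) → v.Completion) : ℝ :=
  Real.log ((‖evalAt F v z‖ ^ v.mult) ^ (1 / (d : ℝ)))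

theorem measurable_etaAt (v : InfinitePlace K) : Measurable (etaAt d F v) := by
  have := (continuous_evalAt F v).norm.measurable
  exact Real.measurable_log.comp ((this.pow_const _).pow_const _)

theorem measurable_eta : Measurable (eta (m := m) d F) :=
  measurable_pi_lambda _ fun v => (measurable_etaAt v).comp (measurable_pi_apply v)

/-- `c_{K,v}(f) ‖F‖_v ^ (-(m + 1) / d)`. -/
noncomputable def localConst (d : ℕ) (F : Fin (M + 1) → MvPolynomial (Fin (m + 1)) K)
    (v : InfinitePlace K) : ENNReal :=
  cLocal F v * ENNReal.ofReal ((coeffAbs F v ^ v.mult) ^ (-((m + 1 : ℕ) : ℝ) / d))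

theorem IsLift.localConst_ne_top (hF : IsLift d F) (hd : 1 ≤ d) (v : InfinitePlace K) :
    localConst d F v ≠ ⊤ :=
  ENNReal.mul_ne_top (hF.localVolumePow_spec hd v).2.2.1.ne ENNReal.ofReal_ne_top

theorem IsLift.map_etaAt (hF : IsLift d F) (hd : 1 ≤ d) (v : InfinitePlace K) :
    (localVolumePow m v).map (etaAt d F v) = volume.withDensity fun y =>
      localConst d F v *
        ENNReal.ofReal (((m + 1 : ℕ) : ℝ) * Real.exp (((m + 1 : ℕ) : ℝ) * y)) := by
  refine eq_withDensity_exp_of_Iic (hF.localConst_ne_top hd v) (by positivity) fun y => ?_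
  rw [Measure.map_apply (measurable_etaAt v) measurableSet_Iic]
  exact (hF.localVolumePow_spec hd v).2.2.2 y

variable [NumberField K]

theorem lintegral_Iic_mul_exp {n : ℝ} (hn : 0 < n) :
    ∫⁻ y in Set.Iic (0 : ℝ), ENNReal.ofReal (n * Real.exp (n * y)) = 1 := by
  rw [← ofReal_integral_eq_lintegral_ofReal, integral_const_mul, integral_exp_mul_Iic hn]
  · simp [hn.ne']
  · exact (integrableOn_exp_mul_Iic hn 0).const_mul n
  · exact Filter.Eventually.of_forall fun y => by positivity

/-- The half-open box whose image under `latticeCoord` is the logarithmic domain has unit mass with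
respect to the exponential density in the coordinate `w₀`. -/
theorem lintegral_box_mul_exp {ι : Type*} [Fintype ι] [DecidableEq ι] (w₀ : ι) {n : ℝ} (hn : 0 < n) :
    ∫⁻ x in Set.univ.pi fun w : ι => if w = w₀ then Set.Iic (0 : ℝ) else Set.Ico 0 1,
      ENNReal.ofReal (n * Real.exp (n * x w₀)) = 1 := by
  -- Factors `1` away from `w₀` put the integrand in product form for Tonelli.
  have hprod : ∀ x : ι → ℝ, ENNReal.ofReal (n * Real.exp (n * x w₀)) =
      ∏ w, (fun w y => if w = w₀ then ENNReal.ofReal (n * Real.exp (n * y)) else 1) w (x w) := by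
    intro x
    simp
  rw [lintegral_congr hprod, volume_pi, Measure.restrict_pi_pi,
    lintegral_fintype_prod_eq_prod (E := fun _ => ℝ)
      (f := fun w y => if w = w₀ then ENNReal.ofReal (n * Real.exp (n * y)) else 1)]
  · refine Finset.prod_eq_one fun w _ => ?_
    by_cases h : w = w₀
    · simpa [h] using lintegral_Iic_mul_exp hn
    · simp [h]
  · intro w
    by_cases h : w = w₀
    · simp only [h, if_true]
      fun_prop
    · simp [h]

theorem det_latticeCoord_ne_zero {w₀ : InfinitePlace K} {e : {w // w ≠ w₀} ≃ Fin (Units.rank K)}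
    (b : Module.Basis (Fin (Units.rank K)) ℤ (unitLattice K)) :
    LinearMap.det (latticeCoord w₀ e fun i => b i) ≠ 0 := fun h => by
  have := abs_det_latticeCoord (w₀ := w₀) (e := e) b
  rw [h, abs_zero] at this
  exact Units.regulator_ne_zero K this.symm

theorem measurableSet_box {ι : Type*} [Fintype ι] [DecidableEq ι] (w₀ : ι) :
    MeasurableSet (Set.univ.pi fun w : ι => if w = w₀ then Set.Iic (0 : ℝ) else Set.Ico 0 1) := by
  refine MeasurableSet.univ_pi fun w => ?_
  split_ifs
  exacts [measurableSet_Iic, measurableSet_Ico]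

/-- Linear change of variables: the Jacobian is the regulator, and `∑ y_v` becomes the coordinate at
`w₀`. -/
theorem lintegral_image_latticeCoord {w₀ : InfinitePlace K}
    {e : {w // w ≠ w₀} ≃ Fin (Units.rank K)}
    (b : Module.Basis (Fin (Units.rank K)) ℤ (unitLattice K)) [DecidableEq (InfinitePlace K)]
    {n : ℝ} (hn : 0 < n) (C : ENNReal) :
    ∫⁻ y in latticeCoord w₀ e (fun i => b i) ''
      Set.univ.pi fun w => if w = w₀ then Set.Iic (0 : ℝ) else Set.Ico 0 1,
      C * ENNReal.ofReal (n * Real.exp (n * ∑ v, y v)) =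
    ENNReal.ofReal (Units.regulator K) * C := by
  set L := latticeCoord w₀ e (fun i => b i) with hL
  have hdet : |LinearMap.det L| = Units.regulator K := abs_det_latticeCoord b
  have hinj : Function.Injective L :=
    (LinearMap.equivOfDetNeZero L (det_latticeCoord_ne_zero b)).injective
  have h := lintegral_image_eq_lintegral_abs_det_fderiv_mul volume (measurableSet_box w₀) (f := L)
    (f' := fun _ => LinearMap.toContinuousLinearMap L)
    (fun x _ => (LinearMap.toContinuousLinearMap L).hasFDerivWithinAt) hinj.injOn
    (fun y => C * ENNReal.ofReal (n * Real.exp (n * ∑ v, y v)))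
  rw [h]
  have hdet' : |(LinearMap.toContinuousLinearMap L).det| = Units.regulator K := hdet
  simp_rw [hdet', hL, sum_latticeCoord, ← mul_assoc]
  rw [lintegral_const_mul _ (by fun_prop), lintegral_box_mul_exp w₀ hn, mul_one]

/-- The set of `y` with `∑ y ≤ 0` whose projection lies in the parallelotope. -/
def logDomain (b : Module.Basis (Fin (Units.rank K)) ℤ (unitLattice K)) :
    Set (InfinitePlace K → ℝ) :=
  {y | ∑ v, y v ≤ 0 ∧ pr y ∈ parallelotope b}

theorem measurableSet_image_latticeCoord {w₀ : InfinitePlace K}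
    {e : {w // w ≠ w₀} ≃ Fin (Units.rank K)}
    (b : Module.Basis (Fin (Units.rank K)) ℤ (unitLattice K)) {T : Set (InfinitePlace K → ℝ)}
    (hT : MeasurableSet T) : MeasurableSet (latticeCoord w₀ e (fun i => b i) '' T) := by
  exact ((LinearMap.equivOfDetNeZero _
    (det_latticeCoord_ne_zero b)).toContinuousLinearEquiv.toHomeomorph.measurableEmbedding
    |>.measurableSet_image).mpr hT

theorem IsLift.map_eta_msVolume (hF : IsLift d F) (hd : 1 ≤ d) :
    (msVolume K m).map (eta d F) = volume.withDensity fun y : InfinitePlace K → ℝ =>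
      ∏ v, localConst d F v *
        ENNReal.ofReal (((m + 1 : ℕ) : ℝ) * Real.exp (((m + 1 : ℕ) : ℝ) * y v)) := by
  have hfin : ∀ v, SigmaFinite ((volume : Measure ℝ).withDensity fun y => localConst d F v *
      ENNReal.ofReal (((m + 1 : ℕ) : ℝ) * Real.exp (((m + 1 : ℕ) : ℝ) * y))) := fun v =>
    SigmaFinite.withDensity_of_ne_top (Filter.Eventually.of_forall fun y =>
      ENNReal.mul_ne_top (hF.localConst_ne_top hd v) ENNReal.ofReal_ne_top)
  -- A pushforward need not be σ-finite; here this is read off from the finite density.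
  have hmap : ∀ v, SigmaFinite ((localVolumePow m v).map (etaAt d F v)) := fun v => by
    rw [hF.map_etaAt hd v]
    exact hfin v
  have h := Measure.pi_map_pi (μ := fun v : InfinitePlace K => localVolumePow m v)
    (f := fun v => etaAt d F v) fun v => (measurable_etaAt v).aemeasurable
  simp_rw [hF.map_etaAt hd] at h
  have h' := pi_withDensity_eq (μ := fun _ : InfinitePlace K => (volume : Measure ℝ))
    (f := fun v y => localConst d F v *
      ENNReal.ofReal (((m + 1 : ℕ) : ℝ) * Real.exp (((m + 1 : ℕ) : ℝ) * y)))
    (fun v => by fun_prop)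
  exact h.trans h'

/-- Of the `r + 1` factors `m + 1`, one per place, one stays with the exponential to normalise its
integral; hence the exponent `r`. -/
theorem prod_localConst_mul_exp (y : InfinitePlace K → ℝ) :
    ∏ v, localConst d F v *
      ENNReal.ofReal (((m + 1 : ℕ) : ℝ) * Real.exp (((m + 1 : ℕ) : ℝ) * y v)) =
    ((∏ v, localConst d F v) * ((m : ENNReal) + 1) ^ Units.rank K) *
      ENNReal.ofReal (((m + 1 : ℕ) : ℝ) * Real.exp (((m + 1 : ℕ) : ℝ) * ∑ v, y v)) := by
  have hcard : Fintype.card (InfinitePlace K) = Units.rank K + 1 := by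
    rw [Units.rank, Nat.sub_add_cancel Fintype.card_pos]
  have hm : ENNReal.ofReal ((m + 1 : ℕ) : ℝ) = (m : ENNReal) + 1 := by
    rw [ENNReal.ofReal_natCast]
    push_cast
    rfl
  have hm0 : (0 : ℝ) ≤ ((m + 1 : ℕ) : ℝ) := Nat.cast_nonneg _
  simp_rw [ENNReal.ofReal_mul hm0, Finset.prod_mul_distrib, Finset.prod_const, Finset.card_univ]
  rw [hcard, hm, Finset.mul_sum, Real.exp_sum,
    ENNReal.ofReal_prod_of_nonneg fun _ _ => (Real.exp_pos _).le]
  ring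

/-- All `z v ≠ 0` is needed: where `F` vanishes, `Real.log 0 = 0` would contribute a factor `1`
instead of `0`. -/
theorem IsLift.rho_eq_exp (hF : IsLift d F) {z : MSSpace K m} (hz : z ∈ etaDom) :
    rho d F z = Real.exp (∑ v, eta d F z v) := by
  rw [Real.exp_sum]
  refine Finset.prod_congr rfl fun v _ => (Real.exp_log ?_).symm
  have : 0 < ‖evalAt F v (z v)‖ := (norm_nonneg _).lt_of_ne fun h =>
    hz v (hF.eq_zero_of_norm_evalAt_eq_zero h.symm)
  positivity

theorem IsLift.domain_eq (hF : IsLift d F)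
    (b : Module.Basis (Fin (Units.rank K)) ℤ (unitLattice K)) :
    domain (m := m) d F (parallelotope b) 1 = etaDom ∩ eta d F ⁻¹' logDomain b := by
  ext z
  refine ⟨fun ⟨h1, h2, h3⟩ => ⟨h2, ?_, h3⟩, fun ⟨h2, h1, h3⟩ => ⟨?_, h2, h3⟩⟩
  · have h1' : rho d F z ≤ 1 := h1
    rwa [hF.rho_eq_exp h2, Real.exp_le_one_iff] at h1'
  · change rho d F z ≤ 1
    rwa [hF.rho_eq_exp h2, Real.exp_le_one_iff]

theorem measurableSet_etaDom : MeasurableSet (etaDom : Set (MSSpace K m)) := by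
  have : (etaDom : Set (MSSpace K m)) = ⋂ v, (fun z => z v) ⁻¹' {0}ᶜ := by
    ext z
    simp [etaDom]
  rw [this]
  exact MeasurableSet.iInter fun v => measurable_pi_apply v (measurableSet_singleton 0).compl

theorem IsLift.etaDom_ae_eq_univ (hF : IsLift d F) (hd : 1 ≤ d) :
    (etaDom : Set (MSSpace K m)) =ᵐ[msVolume K m] Set.univ := by
  have := fun v => (hF.localVolumePow_spec hd v).1
  have hσ : ∀ v : InfinitePlace K, SigmaFinite (localVolumePow m v) := fun v => by
    unfold localVolumePow
    infer_instance
  refine Filter.eventuallyEq_univ.mpr (ae_all_iff.mpr fun v => ?_)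
  exact compl_mem_ae_iff.mpr
    (Measure.pi_eval_preimage_null _ (hF.localVolumePow_spec hd v).2.1)

end SchanuelDomain

open SchanuelDomain in
theorem proposition8p6 {K : Type*} [Field K] [NumberField K] {m M d : ℕ} (hd : 1 ≤ d)
    (F : Fin (M + 1) → MvPolynomial (Fin (m + 1)) K) (hF : SchanuelDomain.IsLift d F)
    (b : Module.Basis (Fin (NumberField.Units.rank K)) ℤ (SchanuelDomain.unitLattice K)) :
    MeasurableSet (SchanuelDomain.domain d F (SchanuelDomain.parallelotope b) 1) ∧
    SchanuelDomain.msVolume K m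
        (SchanuelDomain.domain d F (SchanuelDomain.parallelotope b) 1) < ⊤ ∧
    SchanuelDomain.msVolume K m
        (SchanuelDomain.domain d F (SchanuelDomain.parallelotope b) 1) =
      ((m : ENNReal) + 1) ^ NumberField.Units.rank K *
        ENNReal.ofReal (NumberField.Units.regulator K) *
        SchanuelDomain.cInfty F *
        ENNReal.ofReal (∏ v : NumberField.InfinitePlace K,
          (SchanuelDomain.coeffAbs F v ^ v.mult) ^ (-((m : ℝ) + 1) / (d : ℝ))) := by
  classical
  obtain ⟨w₀⟩ : Nonempty (NumberField.InfinitePlace K) := inferInstance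
  have hcard : Fintype.card {w : NumberField.InfinitePlace K // w ≠ w₀} =
      Fintype.card (Fin (NumberField.Units.rank K)) := by
    rw [Fintype.card_subtype_compl, Fintype.card_fin, NumberField.Units.rank,
      Fintype.card_subtype_eq]
  have hS : logDomain b = _ :=
    setOf_pr_mem_parallelotope_eq_image (e := Fintype.equivOfCardEq hcard) b
  have hSm : MeasurableSet (logDomain b) := by
    rw [hS]
    exact measurableSet_image_latticeCoord b (measurableSet_box w₀)
  have hvol : msVolume K m (domain d F (parallelotope b) 1) =
      ENNReal.ofReal (NumberField.Units.regulator K) *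
        ((∏ v, localConst d F v) * ((m : ENNReal) + 1) ^ NumberField.Units.rank K) := by
    rw [hF.domain_eq, MeasureTheory.measure_congr (MeasureTheory.inter_ae_eq_right_of_ae_eq_univ
      (hF.etaDom_ae_eq_univ hd)),
      ← MeasureTheory.Measure.map_apply measurable_eta hSm, hF.map_eta_msVolume hd,
      MeasureTheory.withDensity_apply _ hSm]
    simp_rw [prod_localConst_mul_exp]
    rw [hS, lintegral_image_latticeCoord b (by positivity)]
  refine ⟨?_, ?_, ?_⟩
  · rw [hF.domain_eq]
    exact measurableSet_etaDom.inter (measurable_eta hSm)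
  · rw [hvol]
    refine ENNReal.mul_lt_top ENNReal.ofReal_lt_top (ENNReal.mul_lt_top ?_ ?_)
    · exact ENNReal.prod_lt_top fun v _ => (hF.localConst_ne_top hd v).lt_top
    · exact ENNReal.pow_lt_top (by simp [ENNReal.add_lt_top])
  · rw [hvol, ENNReal.ofReal_prod_of_nonneg fun v _ =>
      Real.rpow_nonneg (pow_nonneg (hF.coeffAbs_pos v).le _) _]
    simp only [localConst, Finset.prod_mul_distrib, cInfty, Nat.cast_add, Nat.cast_one]
    ring
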